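/- Let $a\ge 1$, $d\ge 2$, $m$ be integers, $p=d(d+1)/2$ and $p_u=d(d-1)/2$. For $i=1,\dots,a$ and $k=1,2,\dots$ let $X_{ik}=\mu_i+\epsilon_{ik}$ be $d$-dimensional random vectors, where $\mu_i\in\mathbb R^d$ and all residuals $\epsilon_{ik}$ are independent, identically distributed within each group $i$, centred ($\mathbb E\,\epsilon_{i1}=0$), with $\mathbb E\|\epsilon_{i1}\|^4<\infty$ and with covariance matrix $V_i=\operatorname{Cov}(\epsilon_{i1})$ having a positive diagonal. Observe $X_{i1},\dots,X_{in_i}$ in group $i$, put $N=\sum_{i=1}^a n_i$, and let the sample sizes grow such that $n_i\to\infty$ and $n_i/N\to\kappa_i\in(0,1]$ for all $i$. Let $\operatorname{vech}$ stack the entries $(j,k)$, $j\le k$, of a $d\times d$ matrix, and $\operatorname{vech}^-$ the entries $(j,k)$, $j<k$. Let $R_i=(V_{ijk}/\sqrt{V_{ijj}V_{ikk}})_{j,k}$ be the correlation matrix of group $i$, $r_i=\operatorname{vech}^-(R_i)$ and $r=(r_1^\top,\dots,r_a^\top)^\top\in\mathbb R^{ap_u}$; let $\widehat r$ be the corresponding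 vector formed from the empirical covariance matrices $\widehat V_i=\frac1{n_i-1}\sum_{k=1}^{n_i}(X_{ik}-\overline X_i)(X_{ik}-\overline X_i)^\top$. Let $\Sigma_i=\operatorname{Cov}(\operatorname{vech}(\epsilon_{i1}\epsilon_{i1}^\top))\in\mathbb R^{p\times p}$, let $$M_i=\Bigl[L-\tfrac12\operatorname{diag}(r_i)M_1\Bigr]\operatorname{diag}\bigl((V_{ijj}V_{ikk})_{j\le k}\bigr)^{-1/2}\in\mathbb R^{p_u\times p},$$ where the row with index $(j,k)$, $j<k$, of $L$ is the unit vector at position $(j,k)$, and that of $M_1$ is the sum of the unit vectors at positions $(j,j)$ and $(k,k)$. Put $\Upsilon_i=M_i\Sigma_iM_i^\top$ and $\Upsilon=\bigoplus_{i=1}^a\kappa_i^{-1}\Upsilon_i$. Let $C\in\mathbb R^{m\times ap_u}$ and $\zeta\in\mathbb R^m$, and let $E_N$ be random $m\times m$ matrices with $E_N\to E$ in probability, where $E\in\mathbb R^{m\times m}$ is deterministic and symmetric. If the null hypothesis $H_0:\ Cr=\zeta$ holds, then $$\widehat Q_r=N\,(C\widehat r-\zeta)^\top E_N\,(C\widehat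 r-\zeta)$$ converges in distribution to $\sum_{\ell=1}^{ap_u}\lambda_\ell B_\ell$, where $\lambda_1,\dots,\lambda_{ap_u}$ are the eigenvalues (with multiplicity) of $\Upsilon^{1/2}C^\top E\,C\,\Upsilon^{1/2}$, and $B_1,\dots,B_{ap_u}$ are independent with the $\chi^2_1$ distribution. -/

import Mathlib

open MeasureTheory ProbabilityTheory Filter Topology
open scoped MatrixOrder Matrix.Norms.L2Operator

noncomputable section

namespace CorrTest

/-- Positions `(j, k)` with `j ≤ k`: the coordinates of `vech` of a `d × d` matrix. -/
abbrev HalfIdx (d : ℕ) : Type := {q : Fin d × Fin d // q.1 ≤ q.2}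

/-- Positions `(j, k)` with `j < k`: the coordinates of the upper-half-vectorization. -/
abbrev UpperIdx (d : ℕ) : Type := {q : Fin d × Fin d // q.1 < q.2}

/-- Coordinates of the pooled vectors: a position `(j, k)` with `j < k`, and a group. -/
abbrev PooledIdx (a d : ℕ) : Type := UpperIdx d × Fin a

/-- The half-vectorization `vech`. -/
def vech {d : ℕ} (A : Matrix (Fin d) (Fin d) ℝ) : HalfIdx d → ℝ :=
  fun q => A q.1.1 q.1.2

/-- The upper-half-vectorization `vech⁻` (entries strictly above the diagonal). -/
def vechUpper {d : ℕ} (A : Matrix (Fin d) (Fin d) ℝ) : UpperIdx d → ℝ :=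
  fun q => A q.1.1 q.1.2

/-- The correlation matrix that belongs to a covariance matrix `V`. -/
def corrOfCov {d : ℕ} (V : Matrix (Fin d) (Fin d) ℝ) : Matrix (Fin d) (Fin d) ℝ :=
  Matrix.of fun j k => V j k / √(V j j * V k k)

/-- The position in `vech` of the `j`-th diagonal entry. -/
def diagIdx {d : ℕ} (j : Fin d) : HalfIdx d := ⟨(j, j), le_rfl⟩

/-- The elimination matrix `L` with `L vech(A) = vech⁻(A)`. -/
def elimMatrix (d : ℕ) : Matrix (UpperIdx d) (HalfIdx d) ℝ :=
  Matrix.of fun l q => if q.1 = l.1 then 1 else 0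

/-- The matrix `M₁`: the row of `(j, k)` is the sum of the unit vectors at the positions of
the diagonal entries `(k, k)` and `(j, j)`. -/
def diagSumMatrix (d : ℕ) : Matrix (UpperIdx d) (HalfIdx d) ℝ :=
  Matrix.of fun l q => (if q = diagIdx l.1.2 then 1 else 0) + (if q = diagIdx l.1.1 then 1 else 0)

/-- `M(v, r) = [L - ½ diag(r) M₁] diag(vech((v₁₁,…,v_dd)ᵀ(v₁₁,…,v_dd)))^{-1/2}`. -/
def corrJacobian {d : ℕ} (v : HalfIdx d → ℝ) (r : UpperIdx d → ℝ) :
    Matrix (UpperIdx d) (HalfIdx d) ℝ :=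
  (elimMatrix d - (1 / 2 : ℝ) • (Matrix.diagonal r * diagSumMatrix d)) *
    Matrix.diagonal fun q => (√(v (diagIdx q.1.1) * v (diagIdx q.1.2)))⁻¹

section Population

variable {Ω : Type*} [MeasurableSpace Ω] {d : ℕ}

/-- The covariance matrix of a random vector. -/
def covMat (P : Measure Ω) (e : Ω → EuclideanSpace ℝ (Fin d)) : Matrix (Fin d) (Fin d) ℝ :=
  Matrix.of fun j k => cov[fun ω => e ω j, fun ω => e ω k; P]

/-- The covariance matrix of `vech(e eᵀ)`. -/
def covVech (P : Measure Ω) (e : Ω → EuclideanSpace ℝ (Fin d)) :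
    Matrix (HalfIdx d) (HalfIdx d) ℝ :=
  Matrix.of fun q q' =>
    cov[fun ω => e ω q.1.1 * e ω q.1.2, fun ω => e ω q'.1.1 * e ω q'.1.2; P]

/-- `Υᵢ = M(vᵢ, rᵢ) Σᵢ M(vᵢ, rᵢ)ᵀ` for a group whose residuals are distributed as `e`. -/
def groupUpsilon (P : Measure Ω) (e : Ω → EuclideanSpace ℝ (Fin d)) :
    Matrix (UpperIdx d) (UpperIdx d) ℝ :=
  let M := corrJacobian (vech (covMat P e)) (vechUpper (corrOfCov (covMat P e)))
  M * covVech P e * M.transpose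

/-- `Υ`, the direct sum of the matrices `κᵢ⁻¹ Υᵢ`. -/
def pooledUpsilon {a : ℕ} (P : Measure Ω) (e : Fin a → Ω → EuclideanSpace ℝ (Fin d))
    (κ : Fin a → ℝ) : Matrix (PooledIdx a d) (PooledIdx a d) ℝ :=
  Matrix.blockDiagonal fun i => (κ i)⁻¹ • groupUpsilon P (e i)

/-- The pooled correlation vector `r`. -/
def pooledCorr {a : ℕ} (P : Measure Ω) (e : Fin a → Ω → EuclideanSpace ℝ (Fin d)) :
    PooledIdx a d → ℝ :=
  fun s => vechUpper (corrOfCov (covMat P (e s.2))) s.1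

end Population

section Sample

variable {d : ℕ}

/-- The mean of the first `n` observations. -/
def sampleMean (x : ℕ → EuclideanSpace ℝ (Fin d)) (n : ℕ) : EuclideanSpace ℝ (Fin d) :=
  (n : ℝ)⁻¹ • ∑ k ∈ Finset.range n, x k

/-- The empirical covariance matrix of the first `n` observations. -/
def sampleCov (x : ℕ → EuclideanSpace ℝ (Fin d)) (n : ℕ) : Matrix (Fin d) (Fin d) ℝ :=
  Matrix.of fun j j' => ((n : ℝ) - 1)⁻¹ *
    ∑ k ∈ Finset.range n, (x k j - sampleMean x n j) * (x k j' - sampleMean x n j')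

/-- The pooled empirical correlation vector, from the first `n i` observations of each group. -/
def pooledSampleCorr {a : ℕ} (x : Fin a → ℕ → EuclideanSpace ℝ (Fin d)) (n : Fin a → ℕ) :
    PooledIdx a d → ℝ :=
  fun s => vechUpper (corrOfCov (sampleCov (x s.2) (n s.2))) s.1

/-- The quadratic form `N (C r̂ - ζ)ᵀ E (C r̂ - ζ)` with `N = ∑ᵢ nᵢ`. -/
def quadForm {a m : ℕ} (C : Matrix (Fin m) (PooledIdx a d) ℝ) (ζ : Fin m → ℝ)
    (E : Matrix (Fin m) (Fin m) ℝ) (x : Fin a → ℕ → EuclideanSpace ℝ (Fin d))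
    (n : Fin a → ℕ) : ℝ :=
  ((∑ i, n i : ℕ) : ℝ) * ((C.mulVec (pooledSampleCorr x n) - ζ) ⬝ᵥ
    E.mulVec (C.mulVec (pooledSampleCorr x n) - ζ))

end Sample

/-- The `χ²` distribution with one degree of freedom: the law of the square of a standard
normal variable. -/
def chiSqOne : Measure ℝ := (gaussianReal 0 1).map fun z => z ^ 2

/-- `U^{1/2} Cᵀ E C U^{1/2}`, with the positive semidefinite square root of `U`. -/
def weightMatrix {a d m : ℕ} (U : Matrix (PooledIdx a d) (PooledIdx a d) ℝ)
    (C : Matrix (Fin m) (PooledIdx a d) ℝ) (E : Matrix (Fin m) (Fin m) ℝ) :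
    Matrix (PooledIdx a d) (PooledIdx a d) ℝ :=
  CFC.sqrt U * C.transpose * E * C * CFC.sqrt U

lemma weightMatrix_isHermitian {a d m : ℕ} (U : Matrix (PooledIdx a d) (PooledIdx a d) ℝ)
    (C : Matrix (Fin m) (PooledIdx a d) ℝ) {E : Matrix (Fin m) (Fin m) ℝ} (hE : E.IsSymm) :
    (weightMatrix U C E).IsHermitian := by
  have hS : (CFC.sqrt U).transpose = CFC.sqrt U := by
    have h : IsSelfAdjoint (CFC.sqrt U) := (CFC.sqrt_nonneg U).isSelfAdjoint
    have h2 : (CFC.sqrt U).conjTranspose = CFC.sqrt U := h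
    rwa [Matrix.conjTranspose_eq_transpose_of_trivial] at h2
  unfold Matrix.IsHermitian weightMatrix
  rw [Matrix.conjTranspose_eq_transpose_of_trivial]
  simp only [Matrix.transpose_mul, hS, hE.eq, Matrix.transpose_transpose, Matrix.mul_assoc]

end CorrTest

end

/-!
The pooled empirical correlations are the value of a function `corrOfMoments`, differentiable at the
true moments, at a vector of sample means of independent vectors, namely of the monomials `εⱼ εₖ`
and the coordinates `εⱼ` of the residuals (`pooledSampleCorr_eq_corrOfMoments`). This identity is
exact, since the correlations are invariant under shifts of the data and under positive rescaling of
the empirical covariance matrix; no remainder from centring at the sample mean has to be estimated.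

A central limit theorem for several independent samples (`tendstoInDistribution_groupMeans`), proved
with characteristic functions and Lévy's theorem from the one-dimensional central limit theorem,
gives a Gaussian limit of the sample means with normalization `√N`. Fourth moments make the
monomials square integrable. The delta method (`tendstoInDistribution_delta`) transfers this to the
correlations; the Jacobian is `M` in the second moments and zero in the first ones
(`hasFDerivAt_corrOfMoments`), so that the limit of `√N (r̂ - r)` is Gaussian with covariance `Υ`
(`tendstoInDistribution_pooledSampleCorr`).

Under the null hypothesis the statistic is the continuous function `(x, E) ↦ (C x)ᵀ E (C x)` of
`√N (r̂ - r)` and `E_N`. Slutsky's theorem gives the limit `(C Z)ᵀ E (C Z)` with `Z` Gaussian with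
covariance `Υ`. Writing `Z` as `Υ^{1/2}` times a standard Gaussian vector and diagonalizing the
resulting matrix identifies its law (`map_sum_eigenvalues_weightMatrix`).
-/

namespace CorrTest

/-! ### Group means: central limit theorem and law of large numbers -/

section MultisampleCLT

variable {Ω : Type*} [MeasurableSpace Ω] {P : Measure Ω} [IsProbabilityMeasure P]

/-- The one-dimensional central limit theorem along sample sizes `n ν → ∞`, on the level of
characteristic functions. The normalization `c ν` need not be `1 / √(n ν)`, only asymptotically
proportional to it; in the multisample setting it is `√N / n ν`. -/
lemma tendsto_charFun_const_mul_sum {η : ℕ → Ω → ℝ} (hL2 : MemLp (η 0) 2 P)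
    (hmean : P[η 0] = 0) (hindep : iIndepFun η P)
    (hident : ∀ k, IdentDistrib (η k) (η 0) P P)
    {n : ℕ → ℕ} (hn : Tendsto n atTop atTop) {c : ℕ → ℝ} {c₀ : ℝ}
    (hc : Tendsto (fun ν => c ν * √(n ν)) atTop (𝓝 c₀)) :
    Tendsto (fun ν => charFun (P.map fun ω => c ν * ∑ k ∈ Finset.range (n ν), η k ω) 1) atTop
      (𝓝 (Complex.exp (-(c₀ ^ 2 * Var[η 0; P] : ℝ) / 2))) := by
  have hclt := tendstoInDistribution_inv_sqrt_mul_sum_sub (P := P) (P' := gaussianReal 0 _)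
    (Y := id) HasLaw.id hL2 hindep hident
  have hclt' : TendstoInDistribution
      (fun (ν : ℕ) ω => (√(n ν))⁻¹ * (∑ k ∈ Finset.range (n ν), η k ω - n ν * P[η 0])) atTop id
      (fun _ => P) (gaussianReal 0 Var[η 0; P].toNNReal) :=
    ⟨fun ν => hclt.forall_aemeasurable (n ν), hclt.aemeasurable_limit, hclt.tendsto.comp hn⟩
  have hslut := hclt'.continuous_comp_prodMk_of_tendstoInMeasure_const
    (g := fun x : ℝ × ℝ => x.1 * x.2) (by fun_prop)
    (Y := fun ν _ => c ν * √(n ν)) (c := c₀)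
    (tendstoInMeasure_of_tendsto_ae (fun _ => by fun_prop) (ae_of_all _ fun _ => hc))
    (fun _ => by fun_prop)
  have hchar := (ProbabilityMeasure.tendsto_iff_tendsto_charFun.1 hslut.tendsto) 1
  have hlim : charFun ((gaussianReal 0 Var[η 0; P].toNNReal).map fun x => id x * c₀) 1 =
      Complex.exp (-(c₀ ^ 2 * Var[η 0; P] : ℝ) / 2) := by
    have h := gaussianReal_map_mul_const (μ := 0) (v := Var[η 0; P].toNNReal) c₀
    simp only [id]
    rw [h, charFun_gaussianReal]
    congr 1
    have : ((c₀ ^ 2 * Var[η 0; P] : ℝ) : ℂ) = (c₀ : ℂ) ^ 2 * (Var[η 0; P] : ℂ) := by push_cast; rfl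
    simp [this, Real.coe_toNNReal _ (variance_nonneg _ _)]
    ring
  refine (hchar.congr' ?_).trans (by rw [← hlim]; rfl)
  filter_upwards [hn.eventually_ge_atTop 1] with ν hν
  have hpos : √(n ν : ℝ) ≠ 0 := by positivity
  simp only [ProbabilityMeasure.coe_mk]
  congr 2
  ext ω
  rw [hmean]
  field_simp
  ring

/-- The vector of the coordinatewise means, over the first `n i` observations `Y i k` of each
group `i`. Coordinates are pairs of a coordinate of the observations and a group; a group without
observations contributes `0`. -/
noncomputable def groupMeans {ι γ : Type*} (Y : γ → ℕ → EuclideanSpace ℝ ι) (n : γ → ℕ) :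
    EuclideanSpace ℝ (ι × γ) :=
  WithLp.toLp 2 fun p => (n p.2 : ℝ)⁻¹ * ∑ k ∈ Finset.range (n p.2), Y p.2 k p.1

/-- The covariance matrix of the coordinates of a random vector. -/
noncomputable def covarianceMatrix {ι : Type*} (P : Measure Ω) (Y : Ω → EuclideanSpace ℝ ι) :
    Matrix ι ι ℝ :=
  Matrix.of fun l l' => cov[fun ω => Y ω l, fun ω => Y ω l'; P]

/-- The vector of the coordinatewise expectations of the first observation of each group. -/
noncomputable def groupExpectations {ι γ : Type*} (P : Measure Ω)
    (Y : γ → ℕ → Ω → EuclideanSpace ℝ ι) :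
    EuclideanSpace ℝ (ι × γ) :=
  WithLp.toLp 2 fun p => ∫ ω, Y p.2 0 ω p.1 ∂P

variable {ι γ : Type*} [Fintype ι]

lemma dotProduct_covarianceMatrix_mulVec {Y : Ω → EuclideanSpace ℝ ι}
    (hY : ∀ l, MemLp (fun ω => Y ω l) 2 P) (t : ι → ℝ) :
    t ⬝ᵥ (covarianceMatrix P Y).mulVec t = Var[fun ω => ∑ l, t l * Y ω l; P] := by
  rw [variance_fun_sum fun l => (hY l).const_mul (t l)]
  simp only [dotProduct, Matrix.mulVec, covarianceMatrix, Matrix.of_apply, Finset.mul_sum]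
  refine Finset.sum_congr rfl fun l _ => Finset.sum_congr rfl fun l' _ => ?_
  rw [covariance_const_mul_left, covariance_const_mul_right]
  ring

lemma posSemidef_covarianceMatrix {Y : Ω → EuclideanSpace ℝ ι}
    (hY : ∀ l, MemLp (fun ω => Y ω l) 2 P) :
    (covarianceMatrix P Y).PosSemidef := by
  refine Matrix.PosSemidef.of_dotProduct_mulVec_nonneg ?_ fun t => ?_
  · ext l l'
    simp [covarianceMatrix, covariance_comm]
  · rw [star_trivial, dotProduct_covarianceMatrix_mulVec hY]
    exact variance_nonneg _ _

lemma dotProduct_blockDiagonal_mulVec [Fintype γ] [DecidableEq γ] (S : γ → Matrix ι ι ℝ)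
    (t : ι × γ → ℝ) :
    t ⬝ᵥ (Matrix.blockDiagonal S).mulVec t =
      ∑ i, (fun l => t (l, i)) ⬝ᵥ (S i).mulVec fun l => t (l, i) := by
  simp only [dotProduct, Matrix.mulVec, Fintype.sum_prod_type_right, Matrix.blockDiagonal_apply]
  simp [ite_mul]

lemma posSemidef_blockDiagonal [Fintype γ] [DecidableEq γ] {S : γ → Matrix ι ι ℝ}
    (hS : ∀ i, (S i).PosSemidef) : (Matrix.blockDiagonal S).PosSemidef := by
  refine Matrix.PosSemidef.of_dotProduct_mulVec_nonneg ?_ fun t => ?_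
  · rw [Matrix.IsHermitian, Matrix.blockDiagonal_conjTranspose]
    congr 1
    ext1 i
    exact (hS i).isHermitian
  · rw [star_trivial, dotProduct_blockDiagonal_mulVec]
    exact Finset.sum_nonneg fun i _ => by
      simpa using (hS i).dotProduct_mulVec_nonneg fun l => t (l, i)

/-- **Central limit theorem for several independent samples** with different sample sizes and one
common normalization `s ν`, where `s ν / √(n ν i) → c i`. By independence the characteristic
function of the vector of group means is a product over the groups, and each factor is the
characteristic function of a one-dimensional normalized sum. -/
theorem tendstoInDistribution_groupMeans [DecidableEq ι] [Fintype γ] [DecidableEq γ]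
    {Y : γ → ℕ → Ω → EuclideanSpace ℝ ι} (hL2 : ∀ i l, MemLp (fun ω => Y i 0 ω l) 2 P)
    (hindep : iIndepFun (fun s : γ × ℕ => Y s.1 s.2) P)
    (hident : ∀ i k, IdentDistrib (Y i k) (Y i 0) P P)
    {n : ℕ → γ → ℕ} (hn : ∀ i, Tendsto (fun ν => n ν i) atTop atTop)
    {s : ℕ → ℝ} {c : γ → ℝ}
    (hc : ∀ i, Tendsto (fun ν => s ν / √(n ν i)) atTop (𝓝 (c i))) :
    TendstoInDistribution
      (fun ν ω => s ν • (groupMeans (fun i k => Y i k ω) (n ν) - groupExpectations P Y))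
      atTop id (fun _ => P)
      (multivariateGaussian 0
        (Matrix.blockDiagonal fun i => c i ^ 2 • covarianceMatrix P (Y i 0))) := by
  have hYm i k : AEMeasurable (Y i k) P := (hident i k).aemeasurable_fst
  have hYl i k l : AEMeasurable (fun ω => Y i k ω l) P := by have := hYm i k; fun_prop
  have hmeas ν : AEMeasurable
      (fun ω => s ν • (groupMeans (fun i k => Y i k ω) (n ν) - groupExpectations P Y)) P := by
    unfold groupMeans
    fun_prop
  refine ⟨hmeas, by fun_prop, ?_⟩
  refine ProbabilityMeasure.tendsto_iff_tendsto_charFun.2 fun t => ?_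
  have hpsd : (Matrix.blockDiagonal fun i => c i ^ 2 • covarianceMatrix P (Y i 0)).PosSemidef :=
    posSemidef_blockDiagonal fun i =>
      (posSemidef_covarianceMatrix (hL2 i)).smul (sq_nonneg (c i))
  -- the centred projections on the direction `t`
  let F : γ → EuclideanSpace ℝ ι → ℝ := fun i y =>
    ∑ l, t (l, i) * (y l - ∫ ω, Y i 0 ω l ∂P)
  have hF i : Measurable (F i) := by fun_prop
  let η : γ → ℕ → Ω → ℝ := fun i k ω => F i (Y i k ω)
  have hηm i k : AEMeasurable (η i k) P := (hF i).comp_aemeasurable (hYm i k)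
  have hη2 i : MemLp (η i 0) 2 P := by
    refine memLp_finsetSum _ fun l _ => MemLp.const_mul ?_ _
    exact (hL2 i l).sub (memLp_const _)
  have hη0 i : P[η i 0] = 0 := by
    have hint l : Integrable (fun ω => Y i 0 ω l) P := (hL2 i l).integrable (by norm_num)
    simp only [η, F]
    rw [integral_finsetSum]
    swap
    · exact fun l _ => ((hint l).sub (integrable_const _)).const_mul _
    refine Finset.sum_eq_zero fun l _ => ?_
    rw [integral_const_mul, integral_sub (hint l) (integrable_const _)]
    simp
  have hηind : iIndepFun (fun s : γ × ℕ => η s.1 s.2) P :=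
    hindep.comp (fun s => F s.1) fun s => hF s.1
  have hηid i k : IdentDistrib (η i k) (η i 0) P P := (hident i k).comp (hF i)
  have hvar i : Var[η i 0; P] =
      (fun l => t (l, i)) ⬝ᵥ (covarianceMatrix P (Y i 0)).mulVec fun l => t (l, i) := by
    rw [dotProduct_covarianceMatrix_mulVec (hL2 i)]
    have : η i 0 = fun ω => (∑ l, t (l, i) * Y i 0 ω l) -
        ∑ l, t (l, i) * ∫ ω, Y i 0 ω l ∂P := by
      ext ω; simp [η, F, mul_sub]
    rw [this, variance_sub_const]
    exact (Finset.aemeasurable_fun_sum _ fun l _ => (hYl i 0 l).const_mul _).aestronglyMeasurable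
  have hgroup i := tendsto_charFun_const_mul_sum (hη2 i) (hη0 i)
    (hηind.precomp (g := fun k : ℕ => (i, k)) fun _ _ h => (Prod.mk.inj h).2) (hηid i) (hn i)
    (c := fun ν => s ν / n ν i) (c₀ := c i) (by
      refine (hc i).congr fun ν => ?_
      rcases Nat.eq_zero_or_pos (n ν i) with h | h
      · simp [h]
      · have : √(n ν i : ℝ) ≠ 0 := by positivity
        have h2 : (n ν i : ℝ) = √(n ν i : ℝ) * √(n ν i : ℝ) :=
          (Real.mul_self_sqrt (by positivity)).symm
        rw [h2, Real.sqrt_mul_self (by positivity)]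
        field_simp)
  have hlim := tendsto_finsetProd (Finset.univ : Finset γ) fun i _ => hgroup i
  have hval : charFun (multivariateGaussian 0
        (Matrix.blockDiagonal fun i => c i ^ 2 • covarianceMatrix P (Y i 0))) t =
      ∏ i, Complex.exp (-(c i ^ 2 * Var[η i 0; P] : ℝ) / 2) := by
    rw [charFun_multivariateGaussian hpsd, ← Complex.exp_sum, dotProduct_blockDiagonal_mulVec]
    congr 1
    simp only [Matrix.smul_mulVec, dotProduct_smul, ← hvar, smul_eq_mul, inner_zero_right]
    push_cast
    rw [← Finset.sum_div, Finset.sum_neg_distrib]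
    ring
  simp only [ProbabilityMeasure.coe_mk, Measure.map_id]
  rw [hval]
  refine hlim.congr' ?_
  -- For an empty group the mean is `0` by convention and the identity `hsum` fails.
  have hn1 : ∀ᶠ ν in atTop, ∀ i, 1 ≤ n ν i :=
    eventually_all.2 fun i => (hn i).eventually_ge_atTop 1
  filter_upwards [hn1] with ν hν
  have hsum : ∀ ω, inner ℝ
      (s ν • (groupMeans (fun i k => Y i k ω) (n ν) - groupExpectations P Y)) t =
        ∑ i, s ν / n ν i * ∑ k ∈ Finset.range (n ν i), η i k ω := by
    intro ω
    simp only [PiLp.inner_apply, Fintype.sum_prod_type_right, η, F]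
    refine Finset.sum_congr rfl fun i _ => ?_
    have hpos : (n ν i : ℝ) ≠ 0 := by have := hν i; positivity
    rw [Finset.sum_comm, Finset.mul_sum]
    refine Finset.sum_congr rfl fun l _ => ?_
    simp only [groupMeans, groupExpectations, PiLp.smul_apply, PiLp.sub_apply, smul_eq_mul,
      RCLike.inner_apply, conj_trivial, ← Finset.mul_sum, Finset.sum_sub_distrib,
      Finset.sum_const, Finset.card_range, nsmul_eq_mul]
    field_simp
  -- Dependent pairs index the observations because the groups have different sizes.
  have hJind : iIndepFun (fun (p : Σ _ : γ, ℕ) ω => s ν / n ν p.1 * η p.1 p.2 ω) P :=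
    (hηind.comp (fun p x => s ν / n ν p.1 * x) fun _ => by fun_prop).precomp
      (g := fun p : Σ _ : γ, ℕ => (p.1, p.2)) fun p q h => by
        obtain ⟨i, k⟩ := p; obtain ⟨i', k'⟩ := q; simpa using h
  have hgprod i : charFun
      (P.map fun ω => s ν / n ν i * ∑ k ∈ Finset.range (n ν i), η i k ω) 1 =
        ∏ k ∈ Finset.range (n ν i), charFun (P.map fun ω => s ν / n ν i * η i k ω) 1 := by
    simp only [Finset.mul_sum]
    rw [iIndepFun.charFun_map_fun_finsetSum_eq_prod (X := fun k ω => s ν / n ν i * η i k ω)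
      (fun k _ => (hηm i k).const_mul _)
      ((hJind.precomp (g := fun k : ℕ => (⟨i, k⟩ : Σ _ : γ, ℕ))
        fun _ _ h => by simpa using h).restrict _)]
    exact Finset.prod_apply _ _ _
  have hall := (hJind.restrict (Finset.univ.sigma fun i => Finset.range (n ν i))
    ).charFun_map_fun_finsetSum_eq_prod (fun p _ => (hηm p.1 p.2).const_mul _)
  have hchar : charFun (P.map fun ω =>
        s ν • (groupMeans (fun i k => Y i k ω) (n ν) - groupExpectations P Y)) t =
      charFun (P.map fun ω => ∑ p ∈ Finset.univ.sigma fun i => Finset.range (n ν i),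
        s ν / n ν p.1 * η p.1 p.2 ω) 1 := by
    rw [charFun_apply, charFun_apply, integral_map (hmeas ν) (by fun_prop),
      integral_map (Finset.aemeasurable_fun_sum _ fun p _ => (hηm p.1 p.2).const_mul _)
        (by fun_prop)]
    congr 1
    ext ω
    rw [hsum]
    simp [Finset.sum_sigma, Finset.mul_sum]
  rw [hchar, hall, Finset.prod_apply, Finset.prod_sigma]
  exact Finset.prod_congr rfl fun i _ => hgprod i

end MultisampleCLT

/-- Strong law of large numbers for the vector of group means: along any sample sizes that all
tend to infinity, it converges almost surely to the vector of expectations. -/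
lemma ae_tendsto_groupMeans {Ω ι γ : Type*} [MeasurableSpace Ω] {P : Measure Ω}
    [Fintype ι] [Fintype γ]
    {Y : γ → ℕ → Ω → EuclideanSpace ℝ ι} (hint : ∀ i l, Integrable (fun ω => Y i 0 ω l) P)
    (hindep : iIndepFun (fun s : γ × ℕ => Y s.1 s.2) P)
    (hident : ∀ i k, IdentDistrib (Y i k) (Y i 0) P P)
    {n : ℕ → γ → ℕ} (hn : ∀ i, Tendsto (fun ν => n ν i) atTop atTop) :
    ∀ᵐ ω ∂P, Tendsto (fun ν => groupMeans (fun i k => Y i k ω) (n ν)) atTop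
      (𝓝 (groupExpectations P Y)) := by
  have h : ∀ p : ι × γ, ∀ᵐ ω ∂P, Tendsto
      (fun N : ℕ => (N : ℝ)⁻¹ • ∑ k ∈ Finset.range N, Y p.2 k ω p.1) atTop
      (𝓝 (∫ ω, Y p.2 0 ω p.1 ∂P)) := fun p =>
    strong_law_ae (fun k ω => Y p.2 k ω p.1) (hint p.2 p.1)
      (fun k k' hkk' => (hindep.indepFun (i := (p.2, k)) (j := (p.2, k'))
        (by simpa using hkk')).comp (φ := fun y : EuclideanSpace ℝ ι => y p.1)
          (ψ := fun y : EuclideanSpace ℝ ι => y p.1)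
          (by fun_prop) (by fun_prop))
      (fun k => (hident p.2 k).comp (u := fun y : EuclideanSpace ℝ ι => y p.1) (by fun_prop))
  filter_upwards [ae_all_iff.2 h] with ω hω
  refine ((PiLp.continuous_toLp 2 _).tendsto _).comp (tendsto_pi_nhds.2 fun p => ?_)
  exact (hω p).comp (hn p.2)

/-! ### Convergence in distribution and the delta method -/

section ChangeOfLimit

variable {Ω Ω₁ Ω₂ F : Type*} [MeasurableSpace Ω] [MeasurableSpace Ω₁] [MeasurableSpace Ω₂]
  {P : Measure Ω} [IsProbabilityMeasure P] {P₁ : Measure Ω₁} [IsProbabilityMeasure P₁]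
  {P₂ : Measure Ω₂} [IsProbabilityMeasure P₂]
  [TopologicalSpace F] [MeasurableSpace F] [OpensMeasurableSpace F]

/-- Convergence in distribution depends on the limit variable only through its law. -/
lemma tendstoInDistribution_of_map_eq {X : ℕ → Ω → F} {Z : Ω₁ → F} {W : Ω₂ → F}
    (h : TendstoInDistribution X atTop Z (fun _ => P) P₁) (hW : AEMeasurable W P₂)
    (hWZ : P₂.map W = P₁.map Z) : TendstoInDistribution X atTop W (fun _ => P) P₂ := by
  refine ⟨h.forall_aemeasurable, hW, ?_⟩
  have heq : (⟨P₂.map W, Measure.isProbabilityMeasure_map hW⟩ : ProbabilityMeasure F) =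
      ⟨P₁.map Z, Measure.isProbabilityMeasure_map h.aemeasurable_limit⟩ := Subtype.ext hWZ
  rw [heq]
  exact h.tendsto

end ChangeOfLimit

section DeltaMethod

variable {Ω Ω' : Type*} [MeasurableSpace Ω] [MeasurableSpace Ω'] {P : Measure Ω}
  [IsProbabilityMeasure P] {P' : Measure Ω'} [IsProbabilityMeasure P']
  {H K : Type*} [NormedAddCommGroup H] [NormedSpace ℝ H] [MeasurableSpace H] [BorelSpace H]
  [SecondCountableTopology H]
  [NormedAddCommGroup K] [NormedSpace ℝ K] [MeasurableSpace K] [BorelSpace K]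
  [SecondCountableTopology K]

/-- **Delta method.** Differentiability of `f` at the single point `θ` suffices: the linearization
error, divided by `‖x - θ‖`, tends to `0` at `θ`, hence almost surely along `T ν`, and Slutsky's
theorem applies to its product with `‖s ν • (T ν - θ)‖`. -/
theorem tendstoInDistribution_delta {f : H → K} (hf : Measurable f) {f' : H →L[ℝ] K} {θ : H}
    (hf' : HasFDerivAt f f' θ) {T : ℕ → Ω → H} (hT : ∀ ν, AEMeasurable (T ν) P)
    (hTθ : ∀ᵐ ω ∂P, Tendsto (fun ν => T ν ω) atTop (𝓝 θ)) {s : ℕ → ℝ} (hs : ∀ ν, 0 ≤ s ν)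
    {Z : Ω' → H}
    (hZ : TendstoInDistribution (fun ν ω => s ν • (T ν ω - θ)) atTop Z (fun _ => P) P') :
    TendstoInDistribution (fun ν ω => s ν • (f (T ν ω) - f θ)) atTop (fun ω => f' (Z ω))
      (fun _ => P) P' := by
  -- The normalized linearization error; it is `0` at `θ` because `0⁻¹ = 0`.
  let ρ : H → K := fun x => ‖x - θ‖⁻¹ • (f x - f θ - f' (x - θ))
  have hρm : Measurable ρ := by
    have : Measurable fun x => f' (x - θ) := by fun_prop
    fun_prop
  have hρ0 : Tendsto ρ (𝓝 θ) (𝓝 0) := by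
    rw [tendsto_zero_iff_norm_tendsto_zero]
    refine (hasFDerivAt_iff_tendsto.1 hf').congr fun x => ?_
    simp [ρ, norm_smul]
  have key := hZ.continuous_comp_prodMk_of_tendstoInMeasure_const
    (g := fun x : H × K => f' x.1 + ‖x.1‖ • x.2) (by fun_prop)
    (Y := fun ν ω => ρ (T ν ω)) (c := 0)
    (tendstoInMeasure_of_tendsto_ae (fun ν => (hρm.comp_aemeasurable (hT ν)).aestronglyMeasurable)
      (by filter_upwards [hTθ] with ω hω using hρ0.comp hω))
    (fun ν => hρm.comp_aemeasurable (hT ν))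
  convert key using 2
  · ext1 ω
    simp only [ρ, map_smul, norm_smul, Real.norm_of_nonneg (hs _), smul_smul]
    rcases eq_or_ne (T ‹_› ω) θ with h | h
    · simp [h]
    · have : ‖T ‹_› ω - θ‖ ≠ 0 := by simpa [sub_eq_zero] using h
      rw [mul_assoc, mul_inv_cancel₀ this, mul_one, ← smul_add]
      congr 1
      abel
  · simp

end DeltaMethod

section Coordinates

variable {Ω : Type*} [MeasurableSpace Ω] {P : Measure Ω}

lemma tendstoInMeasure_of_forall_coord {ι : Type*} [Fintype ι] {f : ℕ → Ω → ι → ℝ} {g : Ω → ι → ℝ}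
    (h : ∀ i, TendstoInMeasure P (fun ν ω => f ν ω i) atTop (fun ω => g ω i)) :
    TendstoInMeasure P f atTop g := by
  intro δ hδ
  have hsum : Tendsto (fun ν => ∑ i, P {ω | δ ≤ edist (f ν ω i) (g ω i)}) atTop (𝓝 0) := by
    simpa using tendsto_finsetSum Finset.univ fun i _ => h i δ hδ
  refine tendsto_of_tendsto_of_tendsto_of_le_of_le tendsto_const_nhds hsum (fun _ => zero_le)
    fun ν => ?_
  refine (measure_mono fun ω hω => ?_).trans (measure_iUnion_fintype_le P _)
  by_contra hcon
  simp only [Set.mem_iUnion, Set.mem_ofPred_eq, not_exists, not_le] at hcon hω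
  refine absurd hω (not_le.2 ?_)
  rw [edist_pi_def, Finset.sup_lt_iff hδ]
  exact fun i _ => hcon i

end Coordinates

/-! ### Linear images and quadratic forms of Gaussian vectors -/

section GaussianQuadratic

variable {ι κ : Type*} [Fintype ι] [DecidableEq ι] [Fintype κ] [DecidableEq κ]

lemma multivariateGaussian_map_mulVec {S : Matrix ι ι ℝ} (hS : S.PosSemidef)
    (A : Matrix κ ι ℝ) :
    (multivariateGaussian 0 S).map (fun x : EuclideanSpace ℝ ι => WithLp.toLp 2 (A.mulVec x)) =
      multivariateGaussian 0 (A * S * A.transpose) := by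
  have hpsd : (A * S * A.transpose).PosSemidef := by
    simpa using hS.mul_mul_conjTranspose_same A
  have hm : Measurable fun x : EuclideanSpace ℝ ι => WithLp.toLp 2 (A.mulVec x) := by
    refine (PiLp.continuous_toLp 2 _).measurable.comp ?_
    exact (Continuous.matrix_mulVec continuous_const (PiLp.continuous_ofLp 2 _)).measurable
  have := Measure.isProbabilityMeasure_map (μ := multivariateGaussian 0 S) hm.aemeasurable
  refine Measure.ext_of_charFun ?_
  ext t
  have h : charFun ((multivariateGaussian 0 S).map
      fun x : EuclideanSpace ℝ ι => WithLp.toLp 2 (A.mulVec x)) t =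
      charFun (multivariateGaussian 0 S) (WithLp.toLp 2 (A.transpose.mulVec t)) := by
    rw [charFun_apply, charFun_apply, integral_map hm.aemeasurable (by fun_prop)]
    congr! 5 with x
    simp only [EuclideanSpace.inner_eq_star_dotProduct, star_trivial]
    rw [Matrix.mulVec_transpose, Matrix.dotProduct_mulVec]
  rw [h, charFun_multivariateGaussian hS, charFun_multivariateGaussian hpsd]
  simp only [inner_zero_right]
  congr 4
  simp only [← Matrix.mulVec_mulVec, Matrix.dotProduct_mulVec, Matrix.mulVec_transpose]

/-- Diagonalization of a quadratic form in the orthonormal eigenbasis of its matrix. -/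
lemma dotProduct_mulVec_eq_sum_eigenvalues {W : Matrix ι ι ℝ} (hW : W.IsHermitian)
    (x : EuclideanSpace ℝ ι) :
    x ⬝ᵥ W.mulVec x = ∑ l, hW.eigenvalues l * (hW.eigenvectorBasis.repr x l) ^ 2 := by
  have h1 : x ⬝ᵥ W.mulVec x = inner ℝ x (WithLp.toLp 2 (W.mulVec x)) := by
    simp [EuclideanSpace.inner_eq_star_dotProduct, dotProduct_comm]
  rw [h1, ← hW.eigenvectorBasis.sum_inner_mul_inner]
  refine Finset.sum_congr rfl fun l _ => ?_
  have h2 : inner ℝ (hW.eigenvectorBasis l) (WithLp.toLp 2 (W.mulVec x)) =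
      hW.eigenvalues l * inner ℝ (hW.eigenvectorBasis l) x := by
    simp only [EuclideanSpace.inner_eq_star_dotProduct, star_trivial]
    have hWt : W.transpose = W := by simpa [Matrix.IsHermitian] using hW
    rw [dotProduct_comm, Matrix.dotProduct_mulVec, ← Matrix.mulVec_transpose, hWt,
      hW.mulVec_eigenvectorBasis, smul_dotProduct, dotProduct_comm, smul_eq_mul]
  rw [h2, OrthonormalBasis.repr_apply_apply, real_inner_comm]
  ring

variable {Ω' : Type*} [MeasurableSpace Ω'] {P' : Measure Ω'}

/-- A quadratic form `xᵀ W x` of a standard Gaussian vector is distributed as the sum of independent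
`χ²₁` variables weighted by the eigenvalues of `W`: the standard Gaussian law is invariant under
the change to an orthonormal eigenbasis. -/
lemma map_sum_mul_chiSq {W : Matrix ι ι ℝ} (hW : W.IsHermitian) {B : ι → Ω' → ℝ}
    (hBindep : iIndepFun B P') (hBlaw : ∀ l, HasLaw (B l) chiSqOne P') :
    P'.map (fun ω => ∑ l, hW.eigenvalues l * B l ω) =
      (stdGaussian (EuclideanSpace ℝ ι)).map fun x : EuclideanSpace ℝ ι => x ⬝ᵥ W.mulVec x := by
  have hlin : ∀ w : ι → ℝ, Measurable fun b : ι → ℝ => ∑ l, w l * b l := fun w => by fun_prop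
  have hsq : Measurable fun y : EuclideanSpace ℝ ι => ∑ l, hW.eigenvalues l * y l ^ 2 :=
    (hlin hW.eigenvalues).comp
      (f := fun y : EuclideanSpace ℝ ι => fun l => y l ^ 2) (by fun_prop)
  have hB := iIndepFun.hasLaw_pi hBlaw hBindep
  have h1 : P'.map (fun ω => ∑ l, hW.eigenvalues l * B l ω) =
      (Measure.pi fun _ : ι => chiSqOne).map fun b => ∑ l, hW.eigenvalues l * b l := by
    rw [← hB.map_eq, AEMeasurable.map_map_of_aemeasurable (hlin _).aemeasurable hB.aemeasurable]
    rfl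
  have h2 : (Measure.pi fun _ : ι => chiSqOne) =
      (Measure.pi fun _ : ι => gaussianReal 0 1).map fun z l => z l ^ 2 := by
    have : ∀ _ : ι, SigmaFinite ((gaussianReal 0 1).map fun z : ℝ => z ^ 2) := fun _ => by
      have := Measure.isProbabilityMeasure_map (μ := gaussianReal 0 1)
        (f := fun z : ℝ => z ^ 2) (by fun_prop)
      infer_instance
    exact (Measure.pi_map_pi fun _ => by fun_prop).symm
  have h3 : (stdGaussian (EuclideanSpace ℝ ι)).map hW.eigenvectorBasis.repr =
      stdGaussian (EuclideanSpace ℝ ι) := stdGaussian_map _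
  have hq : (fun x : EuclideanSpace ℝ ι => x ⬝ᵥ W.mulVec x) =
      (fun y : EuclideanSpace ℝ ι => ∑ l, hW.eigenvalues l * y l ^ 2) ∘
        hW.eigenvectorBasis.repr := by
    ext x
    exact dotProduct_mulVec_eq_sum_eigenvalues hW x
  rw [h1, h2, Measure.map_map (hlin _) (by fun_prop), hq,
    ← Measure.map_map hsq (by fun_prop), h3, ← map_pi_eq_stdGaussian,
    Measure.map_map hsq (by fun_prop)]
  rfl

end GaussianQuadratic

/-! ### Correlations as a function of empirical moments -/

section Correlation

variable {a d : ℕ}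

/-- The second-order monomials `eⱼ eₖ`, `j ≤ k`, of a vector `e`, together with its coordinates
`eⱼ`. Including the latter makes the empirical correlations an exact function of means of
independent vectors. -/
noncomputable def momentVec (e : EuclideanSpace ℝ (Fin d)) :
    EuclideanSpace ℝ (HalfIdx d ⊕ Fin d) :=
  WithLp.toLp 2 (Sum.elim (fun q => e q.1.1 * e q.1.2) fun j => e j)

/-- The covariance at position `q` in group `i` that belongs to a vector `x` of first and second
moments: the second moment minus the product of the first moments. -/
def centredMoment (x : EuclideanSpace ℝ ((HalfIdx d ⊕ Fin d) × Fin a)) (i : Fin a)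
    (q : HalfIdx d) : ℝ :=
  x (Sum.inl q, i) - x (Sum.inr q.1.1, i) * x (Sum.inr q.1.2, i)

/-- A position strictly above the diagonal, as a position of the half-vectorization. -/
def UpperIdx.toHalf (l : UpperIdx d) : HalfIdx d := ⟨l.1, l.2.le⟩

/-- The pooled correlation vector as a function of the first and second moments of all groups. -/
noncomputable def corrOfMoments (x : EuclideanSpace ℝ ((HalfIdx d ⊕ Fin d) × Fin a)) :
    EuclideanSpace ℝ (PooledIdx a d) :=
  WithLp.toLp 2 fun p => centredMoment x p.2 p.1.toHalf /
    √(centredMoment x p.2 (diagIdx p.1.1.1) * centredMoment x p.2 (diagIdx p.1.1.2))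

lemma measurable_momentVec : Measurable (momentVec (d := d)) := by
  refine (PiLp.continuous_toLp 2 _).measurable.comp (measurable_pi_lambda _ fun s => ?_)
  cases s <;> simp only [Sum.elim_inl, Sum.elim_inr] <;> fun_prop

lemma measurable_corrOfMoments : Measurable (corrOfMoments (a := a) (d := d)) := by
  unfold corrOfMoments centredMoment
  fun_prop

/-- The empirical covariances do not depend on the mean `μ` of the observations, so they can be
computed from the residuals `e`. The identity includes `n i = 0` and `n i = 1`, where both sides
vanish. -/
lemma sampleCov_eq_centredMoment {μ : EuclideanSpace ℝ (Fin d)}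
    {x e : Fin a → ℕ → EuclideanSpace ℝ (Fin d)}
    (i : Fin a) (hx : ∀ k, x i k = μ + e i k) (n : Fin a → ℕ) (q : HalfIdx d) :
    sampleCov (x i) (n i) q.1.1 q.1.2 = ((n i : ℝ) - 1)⁻¹ *
      (n i * centredMoment (groupMeans (fun i k => momentVec (e i k)) n) i q) := by
  rcases Nat.eq_zero_or_pos (n i) with h0 | hpos
  · simp [sampleCov, h0]
  have hn : (n i : ℝ) ≠ 0 := by positivity
  have hdev : ∀ j k, x i k j - sampleMean (x i) (n i) j =
      e i k j - (n i : ℝ)⁻¹ * ∑ k ∈ Finset.range (n i), e i k j := by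
    intro j k
    simp [sampleMean, hx, Finset.sum_add_distrib, hn]
  simp only [sampleCov, Matrix.of_apply, hdev, centredMoment, groupMeans, momentVec,
    Sum.elim_inl, Sum.elim_inr]
  congr 1
  simp only [sub_mul, mul_sub, Finset.sum_sub_distrib, ← Finset.mul_sum, ← Finset.sum_mul,
    Finset.sum_const, Finset.card_range, nsmul_eq_mul]
  field_simp
  ring

/-- Empirical correlations are exactly the correlations of the empirical moments of the residuals:
the factor `n / (n - 1)` cancels. For `n ≤ 1` all numerators are `0`. -/
lemma pooledSampleCorr_eq_corrOfMoments {μ : Fin a → EuclideanSpace ℝ (Fin d)}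
    {x e : Fin a → ℕ → EuclideanSpace ℝ (Fin d)} (hx : ∀ i k, x i k = μ i + e i k)
    (n : Fin a → ℕ) :
    pooledSampleCorr x n = corrOfMoments (groupMeans (fun i k => momentVec (e i k)) n) := by
  ext p
  obtain ⟨l, i⟩ := p
  have h (q : HalfIdx d) := sampleCov_eq_centredMoment i (hx i) n q
  have h1 := h l.toHalf
  have h2 := h (diagIdx l.1.1)
  have h3 := h (diagIdx l.1.2)
  simp only [UpperIdx.toHalf, diagIdx] at h1 h2 h3
  simp only [pooledSampleCorr, vechUpper, corrOfCov, Matrix.of_apply, corrOfMoments, h1, h2, h3,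
    UpperIdx.toHalf, diagIdx]
  rcases Nat.lt_or_ge (n i) 2 with hlt | hge
  · have hz : ∀ q, centredMoment (groupMeans (fun i k => momentVec (e i k)) n) i q = 0 := by
      intro q
      interval_cases hni : n i <;>
        simp [centredMoment, groupMeans, momentVec, hni]
    simp [hz]
  · set t : ℝ := ((n i : ℝ) - 1)⁻¹ * n i with ht
    have htpos : 0 < t := by
      have : (2 : ℝ) ≤ n i := by exact_mod_cast hge
      have : 0 < (n i : ℝ) - 1 := by linarith
      positivity
    simp only [← mul_assoc, ← ht]
    rw [show ∀ u v : ℝ, t * u * t * v = t ^ 2 * (u * v) by intros; ring,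
      Real.sqrt_mul (sq_nonneg t), Real.sqrt_sq htpos.le, mul_div_mul_left _ _ htpos.ne']

/-- The Jacobian of `corrOfMoments` at centred moments with covariance matrices `V i`. The columns
of the first moments vanish, as the means enter the covariances only through products. -/
noncomputable def momentJacobian (V : Fin a → Matrix (Fin d) (Fin d) ℝ) :
    Matrix (PooledIdx a d) ((HalfIdx d ⊕ Fin d) × Fin a) ℝ :=
  Matrix.blockDiagonal fun i =>
    Matrix.fromCols (corrJacobian (vech (V i)) (vechUpper (corrOfCov (V i)))) 0

/-- The defining factorization of `corrJacobian`, in the form of iterated `mulVec`. -/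
lemma corrJacobian_mulVec (v : HalfIdx d → ℝ) (r : UpperIdx d → ℝ) (g : HalfIdx d → ℝ) :
    (corrJacobian v r).mulVec g =
      (elimMatrix d - (1 / 2 : ℝ) • (Matrix.diagonal r * diagSumMatrix d)).mulVec
        ((Matrix.diagonal fun q : HalfIdx d =>
          (√(v (diagIdx q.1.1) * v (diagIdx q.1.2)))⁻¹).mulVec g) :=
  (Matrix.mulVec_mulVec _ _ _).symm

lemma momentJacobian_mulVec (V : Fin a → Matrix (Fin d) (Fin d) ℝ)
    (h : (HalfIdx d ⊕ Fin d) × Fin a → ℝ) (l : UpperIdx d) (i : Fin a) :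
    (momentJacobian V).mulVec h (l, i) =
      (√(V i l.1.1 l.1.1 * V i l.1.2 l.1.2))⁻¹ * h (Sum.inl l.toHalf, i) -
        1 / 2 * vechUpper (corrOfCov (V i)) l *
          ((√(V i l.1.2 l.1.2 * V i l.1.2 l.1.2))⁻¹ * h (Sum.inl (diagIdx l.1.2), i) +
            (√(V i l.1.1 l.1.1 * V i l.1.1 l.1.1))⁻¹ * h (Sum.inl (diagIdx l.1.1), i)) := by
  have hblock : (momentJacobian V).mulVec h (l, i) =
      (corrJacobian (vech (V i)) (vechUpper (corrOfCov (V i)))).mulVec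
        (fun q => h (Sum.inl q, i)) l := by
    simp [momentJacobian, Matrix.mulVec, dotProduct, Matrix.blockDiagonal_apply,
      Fintype.sum_prod_type_right]
  have helim : ∀ g : HalfIdx d → ℝ, (elimMatrix d).mulVec g l = g l.toHalf := fun g => by
    have hl : ∀ q : HalfIdx d, q.1 = l.1 ↔ q = l.toHalf := fun q => by
      simp [UpperIdx.toHalf, Subtype.ext_iff]
    simp [elimMatrix, Matrix.mulVec, dotProduct, hl]
  have hdiag : ∀ g : HalfIdx d → ℝ,
      (diagSumMatrix d).mulVec g l = g (diagIdx l.1.2) + g (diagIdx l.1.1) := fun g => by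
    simp [diagSumMatrix, Matrix.mulVec, dotProduct, add_mul, Finset.sum_add_distrib]
  rw [hblock, corrJacobian_mulVec, Matrix.sub_mulVec, Pi.sub_apply, helim,
    Matrix.smul_mulVec, Pi.smul_apply, ← Matrix.mulVec_mulVec]
  simp only [hdiag, Matrix.mulVec_diagonal, vech, diagIdx, UpperIdx.toHalf, smul_eq_mul]
  ring

/-- At centred moments the products of first moments have derivative zero, so the covariances move
with the second moments alone and the quotient rule yields `corrJacobian`. -/
lemma hasFDerivAt_corrOfMoments {V : Fin a → Matrix (Fin d) (Fin d) ℝ}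
    (hV : ∀ i j, 0 < V i j j) {θ : EuclideanSpace ℝ ((HalfIdx d ⊕ Fin d) × Fin a)}
    (hθ : ∀ i q, θ (Sum.inl q, i) = vech (V i) q) (hθ' : ∀ i j, θ (Sum.inr j, i) = 0) :
    HasFDerivAt corrOfMoments
      (Matrix.toEuclideanLin (momentJacobian V)).toContinuousLinearMap θ := by
  rw [← hasFDerivWithinAt_univ, hasFDerivWithinAt_euclidean]
  rintro ⟨l, i⟩
  rw [hasFDerivWithinAt_univ]
  have hc (q : HalfIdx d) : HasFDerivAt (fun x => centredMoment x i q)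
      (EuclideanSpace.proj (𝕜 := ℝ) (Sum.inl q, i)) θ := by
    have hp (s : (HalfIdx d ⊕ Fin d) × Fin a) :=
      (EuclideanSpace.proj (𝕜 := ℝ) s :
        EuclideanSpace ℝ ((HalfIdx d ⊕ Fin d) × Fin a) →L[ℝ] ℝ).hasFDerivAt (x := θ)
    refine ((hp (Sum.inl q, i)).sub ((hp (Sum.inr q.1.1, i)).mul (hp (Sum.inr q.1.2, i)))
      ).congr_fderiv ?_
    simp [hθ']
  have hcθ (q : HalfIdx d) : centredMoment θ i q = vech (V i) q := by
    simp [centredMoment, hθ, hθ']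
  have h1 := hV i l.1.1
  have h2 := hV i l.1.2
  have hab : 0 < V i l.1.1 l.1.1 * V i l.1.2 l.1.2 := mul_pos h1 h2
  have hw := (hc (diagIdx l.1.1)).mul (hc (diagIdx l.1.2))
  have hw0 : centredMoment θ i (diagIdx l.1.1) * centredMoment θ i (diagIdx l.1.2) =
      V i l.1.1 l.1.1 * V i l.1.2 l.1.2 := by
    simp [hcθ, vech, diagIdx]
  have hs := hw.sqrt (by simpa [hw0] using hab.ne')
  have hinv := (hasDerivAt_inv (x := √(V i l.1.1 l.1.1 * V i l.1.2 l.1.2))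
    (Real.sqrt_ne_zero'.2 hab))
  rw [← hw0] at hinv
  have hq := (hc l.toHalf).mul (hinv.comp_hasFDerivAt θ hs)
  refine (hq.congr_of_eventuallyEq (Eventually.of_forall fun x => ?_)).congr_fderiv ?_
  · simp [corrOfMoments, div_eq_mul_inv]
  · ext h
    have hsq : V i l.1.1 l.1.1 * V i l.1.2 l.1.2 =
      √(V i l.1.1 l.1.1 * V i l.1.2 l.1.2) ^ 2 := (Real.sq_sqrt hab.le).symm
    have hmul := momentJacobian_mulVec V h l i
    simp only [Real.sqrt_mul_self h1.le, Real.sqrt_mul_self h2.le] at hmul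
    have hs0 : √(V i l.1.1 l.1.1 * V i l.1.2 l.1.2) ≠ 0 := Real.sqrt_ne_zero'.2 hab
    simp [hcθ, vech, hmul, vechUpper, corrOfCov]
    simp only [diagIdx, UpperIdx.toHalf]
    rw [← hsq]
    field_simp
    ring

end Correlation

section Moments

variable {Ω : Type*} [MeasurableSpace Ω] {P : Measure Ω} [IsProbabilityMeasure P]
  {d : ℕ} {e : Ω → EuclideanSpace ℝ (Fin d)}

/-- Fourth moments make the products `eⱼ eₖ` square integrable. -/
lemma memLp_momentVec (he : MemLp e 4 P) (s : HalfIdx d ⊕ Fin d) :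
    MemLp (fun ω => momentVec (e ω) s) 2 P := by
  have hej j : MemLp (fun ω => e ω j) 4 P := he.eval_piLp j
  rcases s with q | j
  · have : ENNReal.HolderTriple 4 4 2 := ⟨by
      rw [← ENNReal.toReal_eq_toReal_iff' (by simp) (by simp),
        ENNReal.toReal_add (by simp) (by simp)]
      norm_num⟩
    exact (hej q.1.2).mul' (hej q.1.1)
  · exact (hej j).mono_exponent (by norm_num)

lemma integral_coord_eq_zero (he : MemLp e 4 P) (h0 : ∫ ω, e ω ∂P = 0) (j : Fin d) :
    ∫ ω, e ω j ∂P = 0 := by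
  rw [← eval_integral_piLp fun j => (he.eval_piLp j).integrable (by norm_num), h0]
  rfl

lemma integral_mul_coord (he : MemLp e 4 P) (h0 : ∫ ω, e ω ∂P = 0) (q : HalfIdx d) :
    ∫ ω, e ω q.1.1 * e ω q.1.2 ∂P = vech (covMat P e) q := by
  have hej j : MemLp (fun ω => e ω j) 2 P := (he.eval_piLp j).mono_exponent (by norm_num)
  simp only [vech, covMat, Matrix.of_apply]
  rw [covariance_eq_sub (hej _) (hej _), integral_coord_eq_zero he h0]
  simp

end Moments

/-- The limit covariance of the delta method is `Υ`: as the Jacobian ignores the first moments,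
only the block `Cov(vech(e eᵀ))` of the covariance matrix of `momentVec e` contributes. -/
lemma momentJacobian_mul_mul_transpose {Ω : Type*} [MeasurableSpace Ω] (P : Measure Ω) {a d : ℕ}
    (e : Fin a → Ω → EuclideanSpace ℝ (Fin d)) (c κ : Fin a → ℝ) (hc : ∀ i, c i ^ 2 = (κ i)⁻¹) :
    momentJacobian (fun i => covMat P (e i)) *
      (Matrix.blockDiagonal fun i => c i ^ 2 • covarianceMatrix P fun ω => momentVec (e i ω)) *
      (momentJacobian fun i => covMat P (e i)).transpose = pooledUpsilon P e κ := by
  rw [momentJacobian, Matrix.blockDiagonal_transpose, ← Matrix.blockDiagonal_mul,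
    ← Matrix.blockDiagonal_mul, pooledUpsilon]
  congr 1
  ext1 i
  have hS : covarianceMatrix P (fun ω => momentVec (e i ω)) =
      Matrix.fromBlocks (covVech P (e i))
        (covarianceMatrix P (fun ω => momentVec (e i ω))).toBlocks₁₂
        (covarianceMatrix P (fun ω => momentVec (e i ω))).toBlocks₂₁
        (covarianceMatrix P (fun ω => momentVec (e i ω))).toBlocks₂₂ :=
    (Matrix.fromBlocks_toBlocks _).symm
  rw [hc, Matrix.mul_smul, Matrix.smul_mul, hS, Matrix.fromCols_mul_fromBlocks,
    Matrix.transpose_fromCols, Matrix.fromCols_mul_fromRows, groupUpsilon]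
  simp

/-! ### Asymptotic distribution of the correlations and of the quadratic form -/

section Assembly

variable {Ω : Type*} [MeasurableSpace Ω] {P : Measure Ω} [IsProbabilityMeasure P] {a d : ℕ}

lemma corrOfMoments_groupExpectations {e : Fin a → ℕ → Ω → EuclideanSpace ℝ (Fin d)}
    (hmoment : ∀ i, MemLp (e i 0) 4 P) (hcentred : ∀ i, ∫ ω, e i 0 ω ∂P = 0) :
    corrOfMoments (groupExpectations P fun i k ω => momentVec (e i k ω)) =
      WithLp.toLp 2 (pooledCorr P fun i => e i 0) := by
  have h (i : Fin a) (q : HalfIdx d) :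
      centredMoment (groupExpectations P fun i k ω => momentVec (e i k ω)) i q =
        vech (covMat P (e i 0)) q := by
    simp only [centredMoment, groupExpectations, momentVec, Sum.elim_inl, Sum.elim_inr,
      integral_mul_coord (hmoment i) (hcentred i), integral_coord_eq_zero (hmoment i) (hcentred i)]
    simp
  ext p
  simp [corrOfMoments, h, vech, pooledCorr, vechUpper, corrOfCov, diagIdx, UpperIdx.toHalf]

/-- Asymptotic normality of the pooled empirical correlations: `√N (r̂ - r)` converges in
distribution to a centred Gaussian vector with covariance matrix `Υ`. -/
theorem tendstoInDistribution_pooledSampleCorr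
    {μ : Fin a → EuclideanSpace ℝ (Fin d)} {ε X : Fin a → ℕ → Ω → EuclideanSpace ℝ (Fin d)}
    (hX : ∀ i k ω, X i k ω = μ i + ε i k ω)
    (hindep : iIndepFun (fun s : Fin a × ℕ => ε s.1 s.2) P)
    (hident : ∀ i k, IdentDistrib (ε i k) (ε i 0) P P)
    (hcentred : ∀ i, ∫ ω, ε i 0 ω ∂P = 0)
    (hmoment : ∀ i, MemLp (ε i 0) 4 P)
    (hvar : ∀ i j, 0 < covMat P (ε i 0) j j)
    {n : ℕ → Fin a → ℕ} {κ : Fin a → ℝ}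
    (hn : ∀ i, Tendsto (fun ν => n ν i) atTop atTop)
    (hκ : ∀ i, 0 < κ i)
    (hratio : ∀ i, Tendsto (fun ν => (n ν i : ℝ) / ((∑ i', n ν i' : ℕ) : ℝ)) atTop (𝓝 (κ i))) :
    TendstoInDistribution
      (fun ν ω => √((∑ i, n ν i : ℕ) : ℝ) • (WithLp.toLp 2
        (pooledSampleCorr (fun i k => X i k ω) (n ν) - pooledCorr P fun i => ε i 0)))
      atTop id (fun _ => P) (multivariateGaussian 0 (pooledUpsilon P (fun i => ε i 0) κ)) := by
  let Y : Fin a → ℕ → Ω → EuclideanSpace ℝ (HalfIdx d ⊕ Fin d) := fun i k ω =>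
    momentVec (ε i k ω)
  have hYindep : iIndepFun (fun s : Fin a × ℕ => Y s.1 s.2) P :=
    hindep.comp (fun _ => momentVec) fun _ => measurable_momentVec
  have hYident i k : IdentDistrib (Y i k) (Y i 0) P P := (hident i k).comp measurable_momentVec
  have hY2 i l : MemLp (fun ω => Y i 0 ω l) 2 P := memLp_momentVec (hmoment i) l
  have hYm i k : AEMeasurable (Y i k) P := (hYident i k).aemeasurable_fst
  let c : Fin a → ℝ := fun i => √(κ i)⁻¹
  have hc i : c i ^ 2 = (κ i)⁻¹ := Real.sq_sqrt (inv_nonneg.2 (hκ i).le)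
  have hscale i : Tendsto (fun ν => √((∑ i, n ν i : ℕ) : ℝ) / √(n ν i : ℝ)) atTop (𝓝 (c i)) := by
    refine ((Real.continuous_sqrt.tendsto _).comp ((hratio i).inv₀ (hκ i).ne')).congr fun ν => ?_
    simp only [Function.comp_apply, inv_div]
    exact Real.sqrt_div (by positivity) _
  have hclt := tendstoInDistribution_groupMeans hY2 hYindep hYident hn hscale
  have hlln := ae_tendsto_groupMeans (fun i l => (hY2 i l).integrable (by norm_num))
    hYindep hYident hn
  have hT ν : AEMeasurable (fun ω => groupMeans (fun i k => Y i k ω) (n ν)) P := by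
    unfold groupMeans
    fun_prop
  have hderiv := hasFDerivAt_corrOfMoments hvar (θ := groupExpectations P Y)
    (fun i q => integral_mul_coord (hmoment i) (hcentred i) q)
    (fun i j => integral_coord_eq_zero (hmoment i) (hcentred i) j)
  have hdelta := tendstoInDistribution_delta measurable_corrOfMoments hderiv hT hlln
    (fun ν => Real.sqrt_nonneg _) hclt
  have hlaw := multivariateGaussian_map_mulVec
    (posSemidef_blockDiagonal fun i =>
      (posSemidef_covarianceMatrix (hY2 i)).smul (sq_nonneg (c i)))
    (momentJacobian fun i => covMat P (ε i 0))
  rw [momentJacobian_mul_mul_transpose P (fun i => ε i 0) c κ hc] at hlaw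
  have hseq : (fun ν ω => √((∑ i, n ν i : ℕ) : ℝ) •
        (corrOfMoments (groupMeans (fun i k => Y i k ω) (n ν)) -
          corrOfMoments (groupExpectations P Y))) =
      fun ν ω => √((∑ i, n ν i : ℕ) : ℝ) • (WithLp.toLp 2
        (pooledSampleCorr (fun i k => X i k ω) (n ν) - pooledCorr P fun i => ε i 0)) := by
    ext ν ω : 2
    rw [pooledSampleCorr_eq_corrOfMoments (fun i k => hX i k ω), WithLp.toLp_sub,
      corrOfMoments_groupExpectations hmoment hcentred]
  rw [hseq] at hdelta
  refine tendstoInDistribution_of_map_eq hdelta aemeasurable_id ?_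
  rw [Measure.map_id, ← hlaw]
  rfl

/-- The weighted `χ²` sum of the limit has the law of `(C x)ᵀ E (C x)` for a centred Gaussian vector
`x` with covariance `Υ`, since `x` is `Υ^{1/2}` applied to a standard Gaussian vector. -/
lemma map_sum_eigenvalues_weightMatrix {m : ℕ} {Υ : Matrix (PooledIdx a d) (PooledIdx a d) ℝ}
    (C : Matrix (Fin m) (PooledIdx a d) ℝ) {E : Matrix (Fin m) (Fin m) ℝ} (hE : E.IsSymm)
    {Ω' : Type*} [MeasurableSpace Ω'] {P' : Measure Ω'}
    {B : PooledIdx a d → Ω' → ℝ} (hBindep : iIndepFun B P')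
    (hBlaw : ∀ l, HasLaw (B l) chiSqOne P') :
    P'.map (fun ω' => ∑ l, (weightMatrix_isHermitian Υ C hE).eigenvalues l * B l ω') =
      (multivariateGaussian 0 Υ).map fun x : EuclideanSpace ℝ (PooledIdx a d) =>
        C.mulVec x ⬝ᵥ E.mulVec (C.mulVec x) := by
  rw [map_sum_mul_chiSq _ hBindep hBlaw, multivariateGaussian, Measure.map_map]
  · congr 1
    ext x
    have hS : (CFC.sqrt Υ).transpose = CFC.sqrt Υ := by
      have h : IsSelfAdjoint (CFC.sqrt Υ) := (CFC.sqrt_nonneg Υ).isSelfAdjoint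
      have h2 : (CFC.sqrt Υ).conjTranspose = CFC.sqrt Υ := h
      rwa [Matrix.conjTranspose_eq_transpose_of_trivial] at h2
    simp only [Function.comp_apply, zero_add, Matrix.ofLp_toEuclideanCLM, weightMatrix,
      Matrix.dotProduct_mulVec]
    rw [← Matrix.vecMul_transpose C, ← Matrix.vecMul_transpose (CFC.sqrt Υ), hS]
    simp only [Matrix.vecMul_vecMul, Matrix.mul_assoc]
  · simp only [dotProduct, Matrix.mulVec]
    fun_prop
  · fun_prop

end Assembly

end CorrTest

theorem theorem2
    {Ω Ω' : Type*} [MeasurableSpace Ω] [MeasurableSpace Ω']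
    (P : Measure Ω) [IsProbabilityMeasure P] (P' : Measure Ω') [IsProbabilityMeasure P']
    (a d m : ℕ) (ha : 1 ≤ a) (hd : 2 ≤ d)
    -- the model: `X i k = μ i + ε i k`
    (μ : Fin a → EuclideanSpace ℝ (Fin d))
    (ε : Fin a → ℕ → Ω → EuclideanSpace ℝ (Fin d))
    (X : Fin a → ℕ → Ω → EuclideanSpace ℝ (Fin d))
    (hX : ∀ i k ω, X i k ω = μ i + ε i k ω)
    (hindep : iIndepFun (fun s : Fin a × ℕ => ε s.1 s.2) P)
    (hident : ∀ i k, IdentDistrib (ε i k) (ε i 0) P P)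
    (hcentred : ∀ i, ∫ ω, ε i 0 ω ∂P = 0)
    (hmoment : ∀ i, MemLp (ε i 0) 4 P)
    (hvar : ∀ i j, 0 < CorrTest.covMat P (ε i 0) j j)
    -- the sample sizes along the asymptotics
    (n : ℕ → Fin a → ℕ) (κ : Fin a → ℝ)
    (hn : ∀ i, Tendsto (fun ν => n ν i) atTop atTop)
    (hκ : ∀ i, κ i ∈ Set.Ioc (0 : ℝ) 1)
    (hratio : ∀ i, Tendsto (fun ν => (n ν i : ℝ) / ((∑ i', n ν i' : ℕ) : ℝ)) atTop (𝓝 (κ i)))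
    -- the null hypothesis
    (C : Matrix (Fin m) (CorrTest.PooledIdx a d) ℝ) (ζ : Fin m → ℝ)
    (hnull : C.mulVec (CorrTest.pooledCorr P fun i => ε i 0) = ζ)
    -- the random matrices of the quadratic forms and their limit in probability
    (EN : ℕ → Ω → Matrix (Fin m) (Fin m) ℝ) (E : Matrix (Fin m) (Fin m) ℝ)
    (hENmeas : ∀ ν j k, AEMeasurable (fun ω => EN ν ω j k) P)
    (hEN : ∀ j k, TendstoInMeasure P (fun ν ω => EN ν ω j k) atTop (fun _ => E j k))
    (hE : E.IsSymm)
    -- independent `χ²` variables with one degree of freedom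
    (B : CorrTest.PooledIdx a d → Ω' → ℝ)
    (hBindep : iIndepFun B P') (hBlaw : ∀ l, HasLaw (B l) CorrTest.chiSqOne P') :
    TendstoInDistribution
      (fun ν ω => CorrTest.quadForm C ζ (EN ν ω) (fun i k => X i k ω) (n ν))
      atTop
      (fun ω' => ∑ l, (CorrTest.weightMatrix_isHermitian
        (CorrTest.pooledUpsilon P (fun i => ε i 0) κ) C hE).eigenvalues l * B l ω')
      (fun _ => P) P' := by
  subst hnull
  have hR := CorrTest.tendstoInDistribution_pooledSampleCorr hX hindep hident hcentred hmoment hvar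
    hn (fun i => (hκ i).1) hratio
  have hg : Continuous fun x : EuclideanSpace ℝ (CorrTest.PooledIdx a d) × (Fin m × Fin m → ℝ) =>
      C.mulVec x.1 ⬝ᵥ (Matrix.of fun j k => x.2 (j, k)).mulVec (C.mulVec x.1) := by
    simp only [dotProduct, Matrix.mulVec, Matrix.of_apply]
    fun_prop
  have hslut := hR.continuous_comp_prodMk_of_tendstoInMeasure_const hg
    (Y := fun ν ω p => EN ν ω p.1 p.2) (c := fun p => E p.1 p.2)
    (CorrTest.tendstoInMeasure_of_forall_coord fun p => hEN p.1 p.2)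
    (fun ν => aemeasurable_pi_lambda _ fun p => hENmeas ν p.1 p.2)
  have hlaw := CorrTest.map_sum_eigenvalues_weightMatrix
    (Υ := CorrTest.pooledUpsilon P (fun i => ε i 0) κ) C hE hBindep hBlaw
  -- Under the null hypothesis `C r̂ - ζ = C (r̂ - r)`; `N` is absorbed as `√N` into both factors.
  have hseq : ∀ ν ω, CorrTest.quadForm C (C.mulVec (CorrTest.pooledCorr P fun i => ε i 0))
      (EN ν ω) (fun i k => X i k ω) (n ν) = C.mulVec (√((∑ i, n ν i : ℕ) : ℝ) •
        (CorrTest.pooledSampleCorr (fun i k => X i k ω) (n ν) -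
          CorrTest.pooledCorr P fun i => ε i 0)) ⬝ᵥ (EN ν ω).mulVec (C.mulVec
            (√((∑ i, n ν i : ℕ) : ℝ) • (CorrTest.pooledSampleCorr (fun i k => X i k ω) (n ν) -
              CorrTest.pooledCorr P fun i => ε i 0))) := by
    intro ν ω
    rw [CorrTest.quadForm, ← Matrix.mulVec_sub, Matrix.mulVec_smul, Matrix.mulVec_smul,
      smul_dotProduct, dotProduct_smul, smul_eq_mul, smul_eq_mul, ← mul_assoc,
      Real.mul_self_sqrt (by positivity)]
  simp only [hseq]
  refine CorrTest.tendstoInDistribution_of_map_eq hslut ?_ hlaw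
  exact Finset.aemeasurable_fun_sum _ fun l _ => (hBlaw l).aemeasurable.const_mul _
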